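/- Let $\|x\|_{\mathbb T}$ denote the distance from $x\in\mathbb R$ to the nearest integer, or, for $x\in\mathbb T=\mathbb R/\mathbb Z$, from any representative of $x$ to the nearest integer. For $\tau\in\mathbb R$ let $WDC(\tau)$ be the set of pairs $(\alpha_1,\alpha_2)\in\mathbb R^2$ for which there is a $c>0$ such that $$\max\big(\|h\alpha_1\|_{\mathbb T},\|h\alpha_2\|_{\mathbb T}\big)\ \ge\ \frac{c}{|h|^{\tau}}\qquad\text{for all } h\in\mathbb Z\setminus\{0\}.$$ Let $\tau>1$ and $\alpha=(\alpha_1,\alpha_2)\in WDC(\tau)$, and suppose that $1,\alpha_1,\alpha_2$ are linearly independent over $\mathbb Q$, that is, the shift $f(x)=x+\alpha$ of $\mathbb T^2=(\mathbb R/\mathbb Z)^2$ is irrational. Then there is a sequence of positive numbers $r_k=r_k(\alpha_1,\alpha_2,\tau)$ with $r_k\to0$ as $k\to\infty$ such that, for every $k$, every Euclidean ball of radius $r_k$ covers the whole of $\mathbb T^2$ in $r_k^{-800\tau^4}$ steps of $f$: for every $x\in\mathbb T^2$, $$\bigcup_{0\le j\le r_k^{-800\tau^4}} f^j\big(B_{r_k}(x)\big)=\mathbb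 T^2,\qquad B_r(x)=\{y\in\mathbb T^2:\ \|y_1-x_1\|_{\mathbb T}^2+\|y_2-x_2\|_{\mathbb T}^2<r^2\},$$ where $j$ ranges over the integers. -/

import Mathlib

/-- The distance from a real number to the nearest integer, as the norm on `ℝ / ℤ`. -/
noncomputable def distZ (x : ℝ) : ℝ := ‖(x : UnitAddCircle)‖

/-- The weak Diophantine pairs of frequencies with constant `c` and exponent `τ`. -/
def WDCWith (c τ : ℝ) : Set (ℝ × ℝ) :=
  {α | ∀ h : ℤ, h ≠ 0 → c / |(h : ℝ)| ^ τ ≤ max (distZ (h * α.1)) (distZ (h * α.2))}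

/-- The weak Diophantine pairs of frequencies with exponent `τ`. -/
def WDC (τ : ℝ) : Set (ℝ × ℝ) := ⋃ c : {c : ℝ // 0 < c}, WDCWith c τ

/-- The shift by `(α₁, α₂)` is irrational: `1, α₁, α₂` are linearly independent over `ℚ`. -/
def IsIrrationalPair (α : ℝ × ℝ) : Prop := LinearIndependent ℚ ![(1 : ℝ), α.1, α.2]

/-- The shift of the torus `(ℝ / ℤ)²` by `(α₁, α₂)`. -/
def torusShift (α : ℝ × ℝ) (x : UnitAddCircle × UnitAddCircle) : UnitAddCircle × UnitAddCircle :=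
  (x.1 + (α.1 : UnitAddCircle), x.2 + (α.2 : UnitAddCircle))

/-- The open ball of the torus `(ℝ / ℤ)²` for the Euclidean distance (Mathlib's `Metric.ball` on
the product type would be a ball for the maximum distance). -/
def euclideanTorusBall (x : UnitAddCircle × UnitAddCircle) (r : ℝ) :
    Set (UnitAddCircle × UnitAddCircle) :=
  {y | ‖y.1 - x.1‖ ^ 2 + ‖y.2 - x.2‖ ^ 2 < r ^ 2}

/-- The set `B` covers the whole space in `N` steps of `f`, where `N` is a real number: the images
`f^j (B)` with `0 ≤ j ≤ N` cover the space. -/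
def CoversInSteps {X : Type*} (f : X → X) (B : Set X) (N : ℝ) : Prop :=
  (⋃ j ∈ {j : ℕ | (j : ℝ) ≤ N}, f^[j] '' B) = Set.univ

/-! The proof passes from simultaneous approximation to the dual linear forms `k·α`, then detects
visits of an orbit to a ball by Fourier analysis.

Transference (`exists_scale_forall_le_distZ`): suppose that at every large scale some `k·α` is very
close to an integer. Take a best vector at one scale and the first strictly better one. Their
determinant `h` is nonzero and makes both `hα₁` and `hα₂` nearly integral, too nearly for `WDC τ`.
Hence at infinitely many scales `n` the small divisors are at least `n ^ (-(2τ+2))`.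

Equidistribution (`le_sum_cos_pow`): the kernel `cos(πx₁)^2n * cos(πx₂)^2n` has frequencies of size
at most `n` and mean at least `1/(4n²)`, so the small divisors bound its orbital sums below. It is
at most `exp(-nr²)` off the `r`-ball, so a long orbit avoiding the ball is impossible. With `r =
n^(-1/3)`, about `n^(2τ+5)` steps suffice, far fewer than `r^(-800τ⁴)`. -/

lemma distZ_eq (x : ℝ) : distZ x = |x - round x| := by
  rw [distZ, UnitAddCircle.norm_eq]

lemma distZ_nonneg (x : ℝ) : 0 ≤ distZ x := norm_nonneg _

lemma distZ_le_abs_sub_intCast (x : ℝ) (m : ℤ) : distZ x ≤ |x - m| := by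
  rw [distZ_eq]; exact round_le x m

lemma two_mul_distZ_le_abs_sin (x : ℝ) : 2 * distZ x ≤ |Real.sin (Real.pi * x)| := by
  have h1 : |Real.sin (Real.pi * x)| = |Real.sin (Real.pi * (x - round x))| := by
    have : Real.pi * (x - round x) = Real.pi * x - (round x : ℤ) * Real.pi := by ring
    rw [this, Real.sin_sub_int_mul_pi, abs_mul]
    simp
  have hpi := Real.pi_pos
  have h2 : |Real.pi * (x - round x)| ≤ Real.pi / 2 := by
    rw [abs_mul, abs_of_pos hpi]
    nlinarith [abs_sub_round x]
  have h3 := Real.mul_abs_le_abs_sin h2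
  rw [h1, distZ_eq]
  refine le_trans (le_of_eq ?_) h3
  rw [abs_mul, abs_of_pos hpi]
  field_simp

lemma IsIrrationalPair.distZ_pos {α : ℝ × ℝ} (hα : IsIrrationalPair α) (k : ℤ × ℤ) (hk : k ≠ 0) :
    0 < distZ (k.1 * α.1 + k.2 * α.2) := by
  refine lt_of_le_of_ne (distZ_nonneg _) fun h => hk ?_
  rw [distZ_eq, eq_comm, abs_eq_zero] at h
  have h3 := Fintype.linearIndependent_iff.1 hα
    ![-(round (k.1 * α.1 + k.2 * α.2) : ℚ), (k.1 : ℚ), (k.2 : ℚ)] (by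
      simp only [Fin.sum_univ_three, Matrix.cons_val, Rat.smul_def]
      push_cast
      linarith)
  have h4 := h3 1
  have h5 := h3 2
  simp only [Matrix.cons_val, Int.cast_eq_zero] at h4 h5
  exact Prod.ext h4 h5

/-! ### Transference from simultaneous to dual approximation -/

/-- Two independent small integral linear forms at `α` yield a simultaneous rational
approximation of `α`, through the cross product. -/
lemma exists_simultaneous_approx {α : ℝ × ℝ} {k k' : ℤ × ℤ} {X : ℕ} {ε : ℝ}
    (hk1 : |k.1| ≤ X) (hk2 : |k.2| ≤ X) (hk1' : |k'.1| ≤ X) (hk2' : |k'.2| ≤ X)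
    (hε : distZ (k.1 * α.1 + k.2 * α.2) ≤ ε)
    (hlt : distZ (k'.1 * α.1 + k'.2 * α.2) < distZ (k.1 * α.1 + k.2 * α.2))
    (hsmall : 2 * X * ε < 1)
    (hout : ¬ (|k'.1| ≤ |k.1| ∧ |k'.2| ≤ |k.2|)) :
    ∃ h : ℤ, h ≠ 0 ∧ |(h : ℝ)| ≤ 2 * X ^ 2 ∧ distZ (h * α.1) ≤ 2 * X * ε ∧
      distZ (h * α.2) ≤ 2 * X * ε := by
  set m := round (k.1 * α.1 + k.2 * α.2) with hm
  set m' := round (k'.1 * α.1 + k'.2 * α.2) with hm'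
  rw [distZ_eq, ← hm] at hε
  rw [distZ_eq, distZ_eq, ← hm, ← hm'] at hlt
  set u := k.1 * α.1 + k.2 * α.2 - m with hu
  set u' := k'.1 * α.1 + k'.2 * α.2 - m' with hu'
  have R : ∀ a : ℤ, |a| ≤ X → |(a : ℝ)| ≤ X := fun a ha => by exact_mod_cast ha
  have hb : ∀ a b : ℤ, |a| ≤ X → |b| ≤ X → |a * u' - b * u| ≤ 2 * X * ε := by
    intro a b ha hb
    have e1 : |a * u'| ≤ X * ε := by
      rw [abs_mul]
      exact mul_le_mul (R a ha) (hlt.le.trans hε) (abs_nonneg _) (by positivity)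
    have e2 : |b * u| ≤ X * ε := by
      rw [abs_mul]
      exact mul_le_mul (R b hb) hε (abs_nonneg _) (by positivity)
    linarith [abs_sub (a * u') (b * u)]
  have hA := hb _ _ hk1 hk1'
  have hB := hb _ _ hk2 hk2'
  -- Eliminating one coordinate of `α` between the two forms leaves a multiple of the other, with
  -- the determinant as coefficient.
  have eA : k.1 * u' - k'.1 * u =
      ((k.1 * k'.2 - k.2 * k'.1 : ℤ) : ℝ) * α.2 - ((k.1 * m' - k'.1 * m : ℤ) : ℝ) := by
    push_cast; rw [hu, hu']; ring
  have eB : -(k.2 * u' - k'.2 * u) =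
      ((k.1 * k'.2 - k.2 * k'.1 : ℤ) : ℝ) * α.1 - ((-(k.2 * m' - k'.2 * m) : ℤ) : ℝ) := by
    push_cast; rw [hu, hu']; ring
  refine ⟨k.1 * k'.2 - k.2 * k'.1, fun h0 => ?_, ?_, ?_, ?_⟩
  -- If the determinant vanishes, both combinations are integers of absolute value below 1, hence
  -- zero. Then `k u' = k' u`, and `|u'| < |u|` makes `k'` no larger than `k`, against `hout`.
  · rw [h0, Int.cast_zero, zero_mul, zero_sub] at eA eB
    have key : ∀ (p : ℤ) (t : ℝ), |t| ≤ 2 * X * ε → t = -(p : ℝ) → t = 0 := by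
      intro p t ht hp
      have : |(p : ℝ)| < 1 := by rw [← abs_neg, ← hp]; linarith
      have : p = 0 := Int.abs_lt_one_iff.1 (by exact_mod_cast this)
      rw [hp, this]; simp
    have zA : (k.1 : ℝ) * u' = k'.1 * u := by
      linarith [key _ _ hA eA]
    have zB : (k.2 : ℝ) * u' = k'.2 * u := by
      linarith [key _ _ (by rw [abs_neg]; exact hB) eB]
    have hupos : 0 < |u| := (abs_nonneg _).trans_lt hlt
    have fin : ∀ a b : ℤ, (a : ℝ) * u' = b * u → |b| ≤ |a| := by
      intro a b hab
      have h1 : |(a : ℝ)| * |u'| = |(b : ℝ)| * |u| := by rw [← abs_mul, hab, abs_mul]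
      have h2 : |(b : ℝ)| ≤ |(a : ℝ)| := by
        refine le_of_mul_le_mul_right ?_ hupos
        rw [← h1]
        exact mul_le_mul_of_nonneg_left hlt.le (abs_nonneg _)
      exact_mod_cast h2
    exact hout ⟨fin _ _ zA, fin _ _ zB⟩
  · push_cast
    have e1 : |(k.1 : ℝ) * k'.2| ≤ X * X := by
      rw [abs_mul]; exact mul_le_mul (R _ hk1) (R _ hk2') (abs_nonneg _) (by positivity)
    have e2 : |(k.2 : ℝ) * k'.1| ≤ X * X := by
      rw [abs_mul]; exact mul_le_mul (R _ hk2) (R _ hk1') (abs_nonneg _) (by positivity)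
    linarith [abs_sub ((k.1 : ℝ) * k'.2) (k.2 * k'.1)]
  · refine (distZ_le_abs_sub_intCast _ (-(k.2 * m' - k'.2 * m))).trans ?_
    rw [← eB, abs_neg]; exact hB
  · refine (distZ_le_abs_sub_intCast _ (k.1 * m' - k'.1 * m)).trans ?_
    rw [← eA]; exact hA

/-- A weakly Diophantine irrational pair satisfies a dual Diophantine condition at infinitely
many scales. -/
lemma exists_scale_forall_le_distZ {τ : ℝ} (hτ : 1 < τ) {α : ℝ × ℝ} (hα : α ∈ WDC τ)
    (hirr : IsIrrationalPair α) (N : ℕ) :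
    ∃ n : ℕ, N ≤ n ∧ ∀ k : ℤ × ℤ, k ≠ 0 → |k.1| ≤ n → |k.2| ≤ n →
      (n : ℝ) ^ (-(2 * τ + 2)) ≤ distZ (k.1 * α.1 + k.2 * α.2) := by
  obtain ⟨⟨c, hc⟩, hαc⟩ := Set.mem_iUnion.1 hα
  simp only at hc hαc
  by_contra! hcon
  set D : ℤ × ℤ → ℝ := fun k => distZ (k.1 * α.1 + k.2 * α.2) with hD
  obtain ⟨C, hC⟩ := exists_nat_gt (4 * 8 ^ τ / c)
  -- `C` gives the final contradiction with `c`; 5 makes `4 / Y < 1`.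
  set n := max N (max C 5) with hn
  have hNn : N ≤ n := le_max_left _ _
  have hCn : C ≤ n := (le_max_left _ _).trans (le_max_right _ _)
  have h5n : 5 ≤ n := (le_max_right _ _).trans (le_max_right _ _)
  obtain ⟨k, ⟨hk0, hk1, hk2⟩, hmin⟩ :
      ∃ k : ℤ × ℤ, (k ≠ 0 ∧ |k.1| ≤ n ∧ |k.2| ≤ n) ∧
        ∀ l : ℤ × ℤ, l ≠ 0 ∧ |l.1| ≤ n ∧ |l.2| ≤ n → D k ≤ D l := by
    have hfin : {k : ℤ × ℤ | k ≠ 0 ∧ |k.1| ≤ n ∧ |k.2| ≤ n}.Finite := by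
      refine ((Set.finite_Icc (-(n : ℤ)) n).prod (Set.finite_Icc (-(n : ℤ)) n)).subset ?_
      rintro l ⟨-, h1, h2⟩
      exact ⟨abs_le.1 h1, abs_le.1 h2⟩
    obtain ⟨l, hl0, hl1, hl2, -⟩ := hcon n hNn
    obtain ⟨k, hk, hk'⟩ := Set.exists_min_image _ D hfin ⟨l, hl0, hl1, hl2⟩
    exact ⟨k, hk, hk'⟩
  have hDk : 0 < D k := hirr.distZ_pos k hk0
  -- Since `D k > 0` by irrationality, failure at a large enough scale yields a vector better than
  -- `k`.
  have hex : ∃ m : ℕ, ∃ l : ℤ × ℤ, l ≠ 0 ∧ |l.1| ≤ m ∧ |l.2| ≤ m ∧ D l < D k := by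
    have ht : Filter.Tendsto (fun m : ℕ => (m : ℝ) ^ (-(2 * τ + 2))) Filter.atTop (nhds 0) :=
      (tendsto_rpow_neg_atTop (by linarith)).comp tendsto_natCast_atTop_atTop
    obtain ⟨m, hm, hm'⟩ := ((ht.eventually_lt_const hDk).and
      (Filter.eventually_ge_atTop N)).exists
    obtain ⟨l, hl0, hl1, hl2, hl⟩ := hcon m hm'
    exact ⟨m, l, hl0, hl1, hl2, hl.trans hm⟩
  classical
  obtain ⟨k', hk'0, hk'1, hk'2, hlt⟩ := Nat.find_spec hex
  have hX := fun m => Nat.find_min hex (m := m)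
  set X := Nat.find hex
  have hnX : n < X := by
    by_contra! h
    have := hmin k' ⟨hk'0, hk'1.trans (by exact_mod_cast h), hk'2.trans (by exact_mod_cast h)⟩
    linarith
  obtain ⟨Y, hY⟩ : ∃ Y, X = Y + 1 := ⟨X - 1, by omega⟩
  have hnY : n ≤ Y := by omega
  have hY5 : (5 : ℝ) ≤ Y := by exact_mod_cast h5n.trans hnY
  have hY0 : (0 : ℝ) < Y := by linarith
  -- `Y = X - 1` is still a scale where nothing beats `k`, so the failure there bounds `D k` itself.
  have hε : D k ≤ (Y : ℝ) ^ (-(2 * τ + 2)) := by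
    obtain ⟨l, hl0, hl1, hl2, hl⟩ := hcon Y (hNn.trans hnY)
    by_contra! h
    exact hX Y (by omega) ⟨l, hl0, hl1, hl2, hl.trans h⟩
  have hXY : (X : ℝ) ≤ 2 * Y := by rw [hY]; push_cast; linarith
  have hXε : 2 * X * (Y : ℝ) ^ (-(2 * τ + 2)) ≤ 4 * (Y : ℝ) ^ (-(2 * τ + 1)) := by
    have : (Y : ℝ) ^ (-(2 * τ + 1)) = Y * (Y : ℝ) ^ (-(2 * τ + 2)) := by
      rw [show -(2 * τ + 1) = 1 + -(2 * τ + 2) by ring, Real.rpow_add hY0, Real.rpow_one]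
    rw [this]
    have : (0 : ℝ) ≤ (Y : ℝ) ^ (-(2 * τ + 2)) := by positivity
    nlinarith
  have hsmall : 4 * (Y : ℝ) ^ (-(2 * τ + 1)) < 1 := by
    have h1 : (Y : ℝ) ^ (-(2 * τ + 1)) ≤ (Y : ℝ) ^ (-1 : ℝ) :=
      Real.rpow_le_rpow_of_exponent_le (by linarith) (by linarith)
    have h2 : (Y : ℝ) ^ (-1 : ℝ) ≤ 5⁻¹ := by
      rw [Real.rpow_neg_one]; exact inv_anti₀ (by norm_num) hY5
    linarith
  have hkX : (n : ℤ) ≤ X := by exact_mod_cast hnX.le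
  obtain ⟨h, hh0, hh, h1, h2⟩ := exists_simultaneous_approx (hk1.trans hkX) (hk2.trans hkX)
    hk'1 hk'2 hε hlt (hXε.trans_lt hsmall)
    (fun ⟨a, b⟩ => (hmin k' ⟨hk'0, a.trans hk1, b.trans hk2⟩).not_gt hlt)
  have hw := (hαc h hh0).trans (max_le (h1.trans hXε) (h2.trans hXε))
  have hhpos : 0 < |(h : ℝ)| := by positivity
  have hhY : |(h : ℝ)| ≤ 8 * (Y : ℝ) ^ (2 : ℝ) := by
    rw [Real.rpow_two]; nlinarith
  have hpow : |(h : ℝ)| ^ τ ≤ 8 ^ τ * (Y : ℝ) ^ (2 * τ) := by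
    rw [Real.rpow_mul hY0.le, ← Real.mul_rpow (by norm_num) (by positivity)]
    exact Real.rpow_le_rpow hhpos.le hhY (by linarith)
  rw [div_le_iff₀ (by positivity)] at hw
  have hY2 : (Y : ℝ) ^ (-(2 * τ + 1)) * (Y : ℝ) ^ (2 * τ) = (Y : ℝ)⁻¹ := by
    rw [← Real.rpow_add hY0, ← Real.rpow_neg_one]; congr 1; ring
  have hfin : c ≤ 4 * 8 ^ τ * (Y : ℝ)⁻¹ := by
    calc c ≤ 4 * (Y : ℝ) ^ (-(2 * τ + 1)) * |(h : ℝ)| ^ τ := hw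
      _ ≤ 4 * (Y : ℝ) ^ (-(2 * τ + 1)) * (8 ^ τ * (Y : ℝ) ^ (2 * τ)) := by gcongr
      _ = 4 * 8 ^ τ * ((Y : ℝ) ^ (-(2 * τ + 1)) * (Y : ℝ) ^ (2 * τ)) := by ring
      _ = _ := by rw [hY2]
  rw [← div_eq_mul_inv, le_div_iff₀ hY0] at hfin
  rw [div_lt_iff₀ hc] at hC
  have : (C : ℝ) ≤ Y := by exact_mod_cast hCn.trans hnY
  nlinarith

/-! ### Orbital sums of the cosine kernel -/

/-- The ratio `z` has `‖z - 1‖ = 2|sin πθ| ≥ 4δ`, while `‖z ^ M - 1‖ ≤ 2`. -/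
lemma norm_geom_sum_exp_le {θ δ : ℝ} (hδ : 0 < δ) (h : δ ≤ distZ θ) (M : ℕ) :
    ‖∑ j ∈ Finset.range M, Complex.exp (2 * Real.pi * Complex.I * θ) ^ j‖ ≤ 1 / (2 * δ) := by
  have hexp : Complex.exp (2 * Real.pi * Complex.I * θ)
      = Complex.exp (Complex.I * ((2 * Real.pi * θ : ℝ) : ℂ)) := by
    congr 1; push_cast; ring
  set z := Complex.exp (2 * Real.pi * Complex.I * θ) with hz
  have hn : ‖z‖ = 1 := by
    rw [hexp, mul_comm, Complex.norm_exp_ofReal_mul_I]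
  have hz1 : 4 * δ ≤ ‖z - 1‖ := by
    rw [hexp, Complex.norm_exp_I_mul_ofReal_sub_one]
    rw [show 2 * Real.pi * θ / 2 = Real.pi * θ by ring, norm_mul, Real.norm_eq_abs,
      Real.norm_eq_abs, abs_two]
    linarith [two_mul_distZ_le_abs_sin θ]
  have hpos : 0 < ‖z - 1‖ := by linarith
  have hne : z ≠ 1 := fun h => by simp [h] at hpos
  rw [geom_sum_eq hne, norm_div, div_le_div_iff₀ hpos (by positivity)]
  have : ‖z ^ M - 1‖ ≤ 2 := by
    refine (norm_sub_le _ _).trans ?_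
    rw [norm_pow, hn]; norm_num
  nlinarith

/-- The Fourier expansion of an even power of the cosine. -/
lemma cos_pow_two_mul_eq_sum (n : ℕ) (x : ℝ) :
    ((Real.cos (Real.pi * x) ^ (2 * n) : ℝ) : ℂ) = ∑ a ∈ Finset.range (2 * n + 1),
      (((2 * n).choose a / 4 ^ n : ℝ) : ℂ) *
        Complex.exp (2 * Real.pi * Complex.I * ((((a : ℤ) - n : ℤ) : ℝ) * x : ℝ)) := by
  push_cast
  rw [Complex.cos, div_pow, add_pow, Finset.sum_div]
  refine Finset.sum_congr rfl fun a ha => ?_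
  have ha' : a ≤ 2 * n := by simpa [Nat.lt_succ_iff] using ha
  rw [← Complex.exp_nat_mul, ← Complex.exp_nat_mul, ← Complex.exp_add, pow_mul]
  have : (a : ℂ) * (Real.pi * x * Complex.I) + ((2 * n - a : ℕ) : ℂ) * (-(Real.pi * x) * Complex.I)
      = 2 * Real.pi * Complex.I * ((a - n) * x) := by
    rw [Nat.cast_sub ha']; push_cast; ring
  rw [this]
  norm_num
  ring

lemma sum_choose_div_four_pow (n : ℕ) :
    ∑ a ∈ Finset.range (2 * n + 1), ((2 * n).choose a / 4 ^ n : ℝ) = 1 := by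
  rw [← Finset.sum_div, div_eq_one_iff_eq (by positivity)]
  have := Nat.sum_range_choose (2 * n)
  rw [pow_mul] at this
  exact_mod_cast this

/-- The orbital sums of the kernel `cos (π x₁) ^ 2n * cos (π x₂) ^ 2n` are bounded below in terms
of the mean of the kernel and the small divisors. -/
lemma le_sum_cos_pow {α : ℝ × ℝ} {n : ℕ} (hn : 0 < n) {δ : ℝ} (hδ : 0 < δ)
    (h : ∀ k : ℤ × ℤ, k ≠ 0 → |k.1| ≤ n → |k.2| ≤ n → δ ≤ distZ (k.1 * α.1 + k.2 * α.2))
    (t : ℝ × ℝ) (M : ℕ) :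
    M / (4 * (n : ℝ) ^ 2) - 1 / (2 * δ) ≤ ∑ j ∈ Finset.range M,
      Real.cos (Real.pi * (j * α.1 - t.1)) ^ (2 * n) *
        Real.cos (Real.pi * (j * α.2 - t.2)) ^ (2 * n) := by
  set S := ∑ j ∈ Finset.range M, Real.cos (Real.pi * (j * α.1 - t.1)) ^ (2 * n) *
        Real.cos (Real.pi * (j * α.2 - t.2)) ^ (2 * n) with hS
  set w : ℕ → ℝ := fun a => (2 * n).choose a / 4 ^ n with hw
  have hw0 : ∀ a, 0 ≤ w a := fun a => by positivity
  set s := Finset.range (2 * n + 1) with hs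
  have hw1 : ∑ a ∈ s, w a = 1 := sum_choose_div_four_pow n
  set e : ℝ → ℂ := fun x => Complex.exp (2 * Real.pi * Complex.I * x) with he
  have hadd : ∀ x y, e (x + y) = e x * e y := fun x y => by
    simp only [he, ← Complex.exp_add]; congr 1; push_cast; ring
  have hpow : ∀ (x : ℝ) (j : ℕ), e (j * x) = e x ^ j := fun x j => by
    simp only [he, ← Complex.exp_nat_mul]; congr 1; push_cast; ring
  have hnorm : ∀ x, ‖e x‖ = 1 := fun x => by
    simp only [he]
    rw [show 2 * Real.pi * Complex.I * x = ((2 * Real.pi * x : ℝ) : ℂ) * Complex.I by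
      push_cast; ring, Complex.norm_exp_ofReal_mul_I]
  set κ : ℕ → ℤ := fun a => (a : ℤ) - n with hκ
  set φ : ℕ × ℕ → ℝ := fun p => -(κ p.1 * t.1 + κ p.2 * t.2) with hφ
  set θ : ℕ × ℕ → ℝ := fun p => κ p.1 * α.1 + κ p.2 * α.2 with hθ
  set T : ℕ × ℕ → ℂ := fun p =>
    ((w p.1 * w p.2 : ℝ) : ℂ) * (e (φ p) * ∑ j ∈ Finset.range M, e (θ p) ^ j) with hT
  have hST : (S : ℂ) = ∑ p ∈ s ×ˢ s, T p := by
    simp only [hT, Finset.mul_sum]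
    rw [hS, Finset.sum_comm, Complex.ofReal_sum]
    refine Finset.sum_congr rfl fun j _ => ?_
    rw [Complex.ofReal_mul, cos_pow_two_mul_eq_sum, cos_pow_two_mul_eq_sum,
      Finset.sum_mul_sum, Finset.sum_product]
    refine Finset.sum_congr rfl fun a _ => Finset.sum_congr rfl fun b _ => ?_
    rw [← hpow, ← hadd]
    have : φ (a, b) + j * θ (a, b) = κ a * (j * α.1 - t.1) + κ b * (j * α.2 - t.2) := by
      simp only [hφ, hθ]; ring
    rw [this, hadd]
    simp only [hw, he, hκ]
    push_cast
    ring
  -- Indices are shifted by `n`, so `(n, n)` is the zero frequency and carries the mean.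
  have hmem : ((n, n) : ℕ × ℕ) ∈ s ×ˢ s := by
    simp only [hs, Finset.mem_product, Finset.mem_range]; omega
  have hTn : T (n, n) = ((w n * w n * M : ℝ) : ℂ) := by
    simp [hT, hφ, hθ, hκ, he]
  have hrest : ‖∑ p ∈ (s ×ˢ s).erase (n, n), T p‖ ≤ 1 / (2 * δ) := by
    calc ‖∑ p ∈ (s ×ˢ s).erase (n, n), T p‖
        ≤ ∑ p ∈ (s ×ˢ s).erase (n, n), w p.1 * w p.2 * (1 / (2 * δ)) := by
          refine norm_sum_le_of_le _ fun p hp => ?_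
          obtain ⟨hne, hp⟩ := Finset.mem_erase.1 hp
          simp only [hs, Finset.mem_product, Finset.mem_range] at hp
          rw [hT]
          simp only
          rw [norm_mul, norm_mul, hnorm, one_mul, Complex.norm_real, Real.norm_eq_abs,
            abs_of_nonneg (mul_nonneg (hw0 _) (hw0 _))]
          refine mul_le_mul_of_nonneg_left ?_ (mul_nonneg (hw0 _) (hw0 _))
          refine norm_geom_sum_exp_le hδ (h (κ p.1, κ p.2) ?_ ?_ ?_) M
          · intro h0
            simp only [hκ, Prod.mk_eq_zero] at h0
            exact hne (Prod.ext (by simp only; omega) (by simp only; omega))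
          · simp only [hκ, abs_le]; omega
          · simp only [hκ, abs_le]; omega
      _ ≤ ∑ p ∈ s ×ˢ s, w p.1 * w p.2 * (1 / (2 * δ)) :=
          Finset.sum_le_sum_of_subset_of_nonneg (Finset.erase_subset _ _) fun p _ _ =>
            mul_nonneg (mul_nonneg (hw0 _) (hw0 _)) (by positivity)
      _ = 1 / (2 * δ) := by
          rw [← Finset.sum_mul, Finset.sum_product]
          simp only
          rw [← Finset.sum_mul_sum, hw1]; ring
  rw [← Finset.add_sum_erase _ _ hmem, hTn] at hST
  have hdiff : |S - w n * w n * M| ≤ 1 / (2 * δ) := by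
    rw [← Real.norm_eq_abs, ← Complex.norm_real, Complex.ofReal_sub, hST, add_sub_cancel_left]
    exact hrest
  have hwn : 1 / (2 * n : ℝ) ≤ w n := by
    rw [hw]
    simp only
    rw [div_le_div_iff₀ (by positivity) (by positivity)]
    have := Nat.four_pow_le_two_mul_self_mul_centralBinom n hn
    rw [Nat.centralBinom_eq_two_mul_choose] at this
    have : (4 ^ n : ℝ) ≤ 2 * n * (2 * n).choose n := by exact_mod_cast this
    linarith
  have hmean : M / (4 * (n : ℝ) ^ 2) ≤ w n * w n * M := by
    have : (1 / (2 * n : ℝ)) * (1 / (2 * n : ℝ)) ≤ w n * w n :=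
      mul_le_mul hwn hwn (by positivity) (hw0 _)
    calc M / (4 * (n : ℝ) ^ 2) = (1 / (2 * n : ℝ)) * (1 / (2 * n : ℝ)) * M := by
          field_simp; norm_num
      _ ≤ _ := mul_le_mul_of_nonneg_right this (by positivity)
  linarith [(abs_le.1 hdiff).1]

/-- Concentration of the kernel: `cos² = 1 - sin² ≤ 1 - ρ² ≤ exp(-ρ²)`. -/
lemma cos_pow_two_mul_le_exp {x ρ : ℝ} (hρ : 0 ≤ ρ) (h : ρ ≤ 2 * distZ x) (n : ℕ) :
    Real.cos (Real.pi * x) ^ (2 * n) ≤ Real.exp (-(n * ρ ^ 2)) := by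
  have h1 : ρ ^ 2 ≤ Real.sin (Real.pi * x) ^ 2 := by
    rw [← sq_abs (Real.sin _)]
    exact pow_le_pow_left₀ hρ (h.trans (two_mul_distZ_le_abs_sin x)) 2
  have h2 : Real.cos (Real.pi * x) ^ 2 ≤ Real.exp (-ρ ^ 2) := by
    have := Real.add_one_le_exp (-ρ ^ 2)
    nlinarith [Real.sin_sq_add_cos_sq (Real.pi * x)]
  rw [pow_mul]
  refine (pow_le_pow_left₀ (sq_nonneg _) h2 n).trans (le_of_eq ?_)
  rw [← Real.exp_nat_mul]; congr 1; ring

/-- Under a dual Diophantine condition at the scale `n`, sufficiently long orbits of the shift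
visit every Euclidean ball. -/
lemma exists_lt_distZ_sq_add_distZ_sq_lt {α : ℝ × ℝ} {n : ℕ} (hn : 0 < n) {δ : ℝ} (hδ : 0 < δ)
    (h : ∀ k : ℤ × ℤ, k ≠ 0 → |k.1| ≤ n → |k.2| ≤ n → δ ≤ distZ (k.1 * α.1 + k.2 * α.2))
    {r : ℝ} (hr : 0 < r) (hnr : Real.exp (-(n * r ^ 2)) ≤ 1 / (8 * (n : ℝ) ^ 2))
    {M : ℕ} (hM : 4 * (n : ℝ) ^ 2 / δ < M) (t : ℝ × ℝ) :
    ∃ j < M, distZ (j * α.1 - t.1) ^ 2 + distZ (j * α.2 - t.2) ^ 2 < r ^ 2 := by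
  by_contra! hcon
  have h1 := le_sum_cos_pow hn hδ h t M
  have h2 : ∑ j ∈ Finset.range M, Real.cos (Real.pi * (j * α.1 - t.1)) ^ (2 * n) *
        Real.cos (Real.pi * (j * α.2 - t.2)) ^ (2 * n) ≤ M * (1 / (8 * (n : ℝ) ^ 2)) := by
    refine (Finset.sum_le_card_nsmul _ _ (1 / (8 * (n : ℝ) ^ 2)) fun j hj => ?_).trans (by simp)
    have hj := hcon j (Finset.mem_range.1 hj)
    have c0 : ∀ x : ℝ, 0 ≤ Real.cos x ^ (2 * n) := fun x => (even_two_mul n).pow_nonneg _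
    have c1 : ∀ x : ℝ, Real.cos x ^ (2 * n) ≤ 1 := fun x => by
      rw [pow_mul]; exact pow_le_one₀ (sq_nonneg _) (Real.cos_sq_le_one x)
    refine le_trans ?_ hnr
    by_cases hx : r ≤ 2 * distZ (j * α.1 - t.1)
    · exact (mul_le_of_le_one_right (c0 _) (c1 _)).trans (cos_pow_two_mul_le_exp hr.le hx n)
    · refine (mul_le_of_le_one_left (c0 _) (c1 _)).trans (cos_pow_two_mul_le_exp hr.le ?_ n)
      -- If both distances were below `r / 2`, the sum of their squares would be below `r² / 2`.
      by_contra! hy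
      nlinarith [distZ_nonneg (j * α.1 - t.1), distZ_nonneg (j * α.2 - t.2)]
  have hn0 : (0 : ℝ) < n := by exact_mod_cast hn
  have h3 : (M : ℝ) / (8 * (n : ℝ) ^ 2) ≤ 1 / (2 * δ) := by
    have : (M : ℝ) / (4 * (n : ℝ) ^ 2) = 2 * (M * (1 / (8 * (n : ℝ) ^ 2))) := by
      field_simp; ring
    have : (M : ℝ) / (8 * (n : ℝ) ^ 2) = M * (1 / (8 * (n : ℝ) ^ 2)) := by ring
    linarith
  rw [div_lt_iff₀ hδ] at hM
  rw [div_le_div_iff₀ (by positivity) (by positivity)] at h3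
  nlinarith

/-! ### From orbit visits to covering, and the choice of radii -/

lemma torusShift_iterate (α : ℝ × ℝ) (j : ℕ) (x : UnitAddCircle × UnitAddCircle) :
    (torusShift α)^[j] x =
      (x.1 + ((j * α.1 : ℝ) : UnitAddCircle), x.2 + ((j * α.2 : ℝ) : UnitAddCircle)) := by
  induction j with
  | zero => simp
  | succ j ih =>
    rw [Function.iterate_succ_apply', ih, torusShift]
    simp only [Nat.cast_succ, add_mul, one_mul, AddCircle.coe_add, add_assoc]

/-- A point `z` lies in the `j`-th image of the ball about `x` exactly when `jα` is within `r` of `z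
- x`. -/
lemma coversInSteps_torusShift {α : ℝ × ℝ} {r L : ℝ} {M : ℕ} (hM : (M : ℝ) ≤ L + 1)
    (h : ∀ t : ℝ × ℝ, ∃ j < M, distZ (j * α.1 - t.1) ^ 2 + distZ (j * α.2 - t.2) ^ 2 < r ^ 2)
    (x : UnitAddCircle × UnitAddCircle) :
    CoversInSteps (torusShift α) (euclideanTorusBall x r) L := by
  refine Set.eq_univ_of_forall fun z => ?_
  obtain ⟨t₁, ht₁⟩ := QuotientAddGroup.mk_surjective (z.1 - x.1)
  obtain ⟨t₂, ht₂⟩ := QuotientAddGroup.mk_surjective (z.2 - x.2)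
  obtain ⟨j, hj, hlt⟩ := h (t₁, t₂)
  have hjM : (j : ℝ) + 1 ≤ M := by exact_mod_cast hj
  refine Set.mem_iUnion₂.2 ⟨j, show (j : ℝ) ≤ L by linarith,
    (z.1 - ((j * α.1 : ℝ) : UnitAddCircle), z.2 - ((j * α.2 : ℝ) : UnitAddCircle)), ?_, ?_⟩
  · have key : ∀ (a b : UnitAddCircle) (u v : ℝ), (v : UnitAddCircle) = a - b →
        ‖a - (u : UnitAddCircle) - b‖ = distZ (u - v) := by
      intro a b u v hv
      rw [distZ, AddCircle.coe_sub, hv, ← norm_neg]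
      congr 1; abel
    change ‖_ - _‖ ^ 2 + ‖_ - _‖ ^ 2 < r ^ 2
    rw [key _ _ _ _ ht₁, key _ _ _ _ ht₂]
    exact hlt
  · rw [torusShift_iterate]
    simp

/-- With `r = n^(-1/3)` the exponent `n r²` is `n^(1/3)`, so the exponential beats any power of `n`.
-/
lemma eventually_exp_neg_rpow_le :
    ∀ᶠ n : ℕ in Filter.atTop,
      Real.exp (-(n * ((n : ℝ) ^ (-(1 / 3) : ℝ)) ^ 2)) ≤ 1 / (8 * (n : ℝ) ^ 2) := by
  have h1 : Filter.Tendsto (fun n : ℕ => (n : ℝ) ^ (1 / 3 : ℝ)) Filter.atTop Filter.atTop :=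
    (tendsto_rpow_atTop (by norm_num)).comp tendsto_natCast_atTop_atTop
  have h2 := (Real.tendsto_pow_mul_exp_neg_atTop_nhds_zero 6).comp h1
  filter_upwards [h2.eventually_lt_const (show (0 : ℝ) < 1 / 8 by norm_num),
    Filter.eventually_gt_atTop 0] with n hn hn0
  have hn0' : (0 : ℝ) < n := by exact_mod_cast hn0
  have e1 : ((n : ℝ) ^ (1 / 3 : ℝ)) ^ 6 = (n : ℝ) ^ 2 := by
    rw [← Real.rpow_natCast, ← Real.rpow_mul hn0'.le, ← Real.rpow_natCast]; norm_num
  have e2 : n * ((n : ℝ) ^ (-(1 / 3) : ℝ)) ^ 2 = (n : ℝ) ^ (1 / 3 : ℝ) := by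
    rw [← Real.rpow_natCast, ← Real.rpow_mul hn0'.le]
    nth_rewrite 1 [← Real.rpow_one (n : ℝ)]
    rw [← Real.rpow_add hn0']; norm_num
  simp only [Function.comp_apply, e1] at hn
  rw [e2, le_div_iff₀ (by positivity)]
  linarith

theorem lemma3p3 (τ : ℝ) (hτ : 1 < τ) (α : ℝ × ℝ) (hα : α ∈ WDC τ)
    (hirr : IsIrrationalPair α) :
    ∃ r : ℕ → ℝ, (∀ k, 0 < r k) ∧ Filter.Tendsto r Filter.atTop (nhds 0) ∧
      ∀ k, ∀ x : UnitAddCircle × UnitAddCircle,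
        CoversInSteps (torusShift α) (euclideanTorusBall x (r k)) (r k ^ (-(800 * τ ^ 4))) := by
  obtain ⟨N₀, hN₀⟩ := Filter.eventually_atTop.1 eventually_exp_neg_rpow_le
  choose n hn hdual using fun k : ℕ =>
    exists_scale_forall_le_distZ hτ hα hirr (max k (max N₀ 4))
  have hnk : ∀ k, k ≤ n k := fun k => (le_max_left _ _).trans (hn k)
  have hnN : ∀ k, N₀ ≤ n k := fun k =>
    ((le_max_left _ _).trans (le_max_right _ _)).trans (hn k)
  have hn4 : ∀ k, (4 : ℝ) ≤ n k := fun k => by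
    exact_mod_cast ((le_max_right _ _).trans (le_max_right _ _)).trans (hn k)
  have hpos : ∀ k, (0 : ℝ) < n k := fun k => by linarith [hn4 k]
  refine ⟨fun k => (n k : ℝ) ^ (-(1 / 3) : ℝ), fun k => Real.rpow_pos_of_pos (hpos k) _, ?_, ?_⟩
  · exact (tendsto_rpow_neg_atTop (by norm_num)).comp
      (tendsto_natCast_atTop_atTop.comp (Filter.tendsto_atTop_mono hnk Filter.tendsto_id))
  · intro k x
    set L := ((n k : ℝ) ^ (-(1 / 3) : ℝ)) ^ (-(800 * τ ^ 4)) with hL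
    have hL0 : 0 ≤ L := by positivity
    refine coversInSteps_torusShift (M := ⌊L⌋₊ + 1) (by
      push_cast; linarith [Nat.floor_le hL0]) (fun t => ?_) x
    refine exists_lt_distZ_sq_add_distZ_sq_lt (by exact_mod_cast hpos k)
      (Real.rpow_pos_of_pos (hpos k) _) (hdual k) (Real.rpow_pos_of_pos (hpos k) _)
      (hN₀ _ (hnN k)) ?_ t
    -- The factor 4 is absorbed by `n k ≥ 4`; then `2τ + 5 ≤ 800τ⁴/3` because `τ > 1`.
    have hτ4 : τ ≤ τ ^ 4 := le_self_pow₀ hτ.le (by norm_num)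
    calc 4 * (n k : ℝ) ^ 2 / (n k : ℝ) ^ (-(2 * τ + 2))
        ≤ n k * (n k : ℝ) ^ 2 / (n k : ℝ) ^ (-(2 * τ + 2)) := by
          gcongr; exact hn4 k
      _ = (n k : ℝ) ^ (2 * τ + 5) := by
          rw [← pow_succ', ← Real.rpow_natCast, ← Real.rpow_sub (hpos k)]
          congr 1; push_cast; ring
      _ ≤ (n k : ℝ) ^ (-(1 / 3) * -(800 * τ ^ 4)) :=
          Real.rpow_le_rpow_of_exponent_le (by linarith [hn4 k]) (by linarith)
      _ = L := by rw [hL, Real.rpow_mul (hpos k).le]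
      _ < _ := by push_cast; exact Nat.lt_floor_add_one L
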